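/- Let $q\in\mathbb C$ with $|q|=1$. An operator $V$ on a complex Hilbert space is a \emph{shift} if it is an isometry and $V^{*n}\to 0$ strongly. A pair $(V_1,V_2)$ is \emph{doubly $q$-commutative} if $V_1V_2=qV_2V_1$ and $V_2V_1^*=qV_1^*V_2$. For a complex Hilbert space $\mathcal E$, let $H^2(\mathbb D^2;\mathcal E)$ be the Hardy space of functions $f(z_1,z_2)=\sum_{i,j\ge 0}z_1^iz_2^ja_{ij}$ on the bidisc with $a_{ij}\in\mathcal E$ and $\|f\|^2=\sum\|a_{ij}\|^2<\infty$, write $H^2(\mathbb D^2)=H^2(\mathbb D^2;\mathbb C)$, let $M_{z_1},M_{z_2}$ be the multiplications by the coordinates, and put $M=M_{z_1}M_{z_2}$. For unimodular $p$ let $\mathfrak s_p$ be the unitary on $H^2(\mathbb D^2;\mathcal E)$ given by $$\mathfrak s_p f=\sum_{n\ge 0}p^nM^n(I-MM^*)M^{*n}f ,$$ so that $\mathfrak s_{\bar p}=\mathfrak s_p^*$. Let $(V_1,V_2)$ be a pair of shift operators on a complex Hilbert space $\mathcal H$. Then: 1. $(V_1,V_2)$ is doubly $q$-commutative if and only if,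 for some complex Hilbert space $\mathcal E$, it is jointly unitarily equivalent to $(M_{z_1}\mathfrak s_q,\ \mathfrak s_{\bar q}M_{z_2})$ on $H^2(\mathbb D^2;\mathcal E)$. 2. $(V_1,V_2)$ is doubly $q$-commutative with $\dim(\ker V_1^*\cap\ker V_2^*)=1$ if and only if it is jointly unitarily equivalent to $(M_{z_1}\mathfrak s_q,\ \mathfrak s_{\bar q}M_{z_2})$ on the scalar Hardy space $H^2(\mathbb D^2)$. -/

import Mathlib

open Complex Filter Topology InnerProductSpace
open scoped ComplexConjugate

universe u v

noncomputable section

namespace QShift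

/-! ### The Hardy space of the bidisc -/

/-- The Hilbert space `ℓ²(ℕ × ℕ; E)` of square summable double sequences in `E`. -/
abbrev Coeff (E : Type u) [NormedAddCommGroup E] : Type u :=
  lp (fun _ : ℕ × ℕ => E) 2

section Hardy

variable (E : Type u) [NormedAddCommGroup E] [InnerProductSpace ℂ E] [CompleteSpace E]

variable {E}

theorem summable_powerSeries (a : Coeff E) (p : UnitDisc × UnitDisc) :
    Summable fun n : ℕ × ℕ => ((p.1 : ℂ) ^ n.1 * (p.2 : ℂ) ^ n.2) • a n := by
  have h : Summable fun n : ℕ × ℕ => ‖(p.1 : ℂ)‖ ^ n.1 * ‖(p.2 : ℂ)‖ ^ n.2 :=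
    (summable_geometric_of_lt_one (norm_nonneg _) p.1.norm_lt_one).mul_of_nonneg
      (summable_geometric_of_lt_one (norm_nonneg _) p.2.norm_lt_one)
      (fun _ => by positivity) (fun _ => by positivity)
  refine Summable.of_norm_bounded (h.mul_right ‖a‖) fun n => ?_
  rw [norm_smul, norm_mul, norm_pow, norm_pow]
  gcongr
  exact lp.norm_apply_le_norm (by norm_num) a n

/-- The function `(z₁, z₂) ↦ ∑ z₁ⁱ z₂ʲ a_{ij}` on the bidisc. -/
def powerSeries : Coeff E →ₗ[ℂ] (UnitDisc × UnitDisc → E) where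
  toFun a p := ∑' n : ℕ × ℕ, ((p.1 : ℂ) ^ n.1 * (p.2 : ℂ) ^ n.2) • a n
  map_add' a b := by
    funext p
    simp only [lp.coeFn_add, Pi.add_apply, smul_add]
    exact (summable_powerSeries a p).tsum_add (summable_powerSeries b p)
  map_smul' c a := by
    funext p
    simp only [lp.coeFn_smul, Pi.smul_apply, RingHom.id_apply]
    rw [← (summable_powerSeries a p).tsum_const_smul c]
    exact tsum_congr fun n => smul_comm _ _ _

theorem coeff_eq_zero_of_hasSum {b : ℕ → E}
    (h : ∀ z : UnitDisc, HasSum (fun n => (z : ℂ) ^ n • b n) 0) : b = 0 := by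
  let P : FormalMultilinearSeries ℂ ℂ E :=
    fun n => ContinuousMultilinearMap.mkPiRing ℂ (Fin n) (b n)
  have hP : ∀ n, P.coeff n = b n := fun n => by
    simp [P, FormalMultilinearSeries.coeff]
  have h0 : HasFPowerSeriesAt (0 : ℂ → E) P 0 := by
    rw [hasFPowerSeriesAt_iff]
    filter_upwards [Metric.ball_mem_nhds (0 : ℂ) one_pos] with z hz
    have hz' : ‖z‖ < 1 := by simpa using hz
    simpa [hP] using h (UnitDisc.mk z hz')
  funext n
  rw [← hP n, h0.eq_zero]
  rfl

theorem powerSeries_injective : Function.Injective (powerSeries (E := E)) := by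
  rw [← LinearMap.ker_eq_bot, LinearMap.ker_eq_bot']
  intro a ha
  have hs : ∀ w : UnitDisc, ∀ i, Summable fun j => ((w : ℂ) ^ j) • a (i, j) := by
    intro w i
    have h : Summable fun j : ℕ => ‖(w : ℂ)‖ ^ j :=
      summable_geometric_of_lt_one (norm_nonneg _) w.norm_lt_one
    refine Summable.of_norm_bounded (h.mul_right ‖a‖) fun n => ?_
    rw [norm_smul, norm_pow]
    gcongr
    exact lp.norm_apply_le_norm (by norm_num) a _
  have h1 : ∀ w : UnitDisc, (fun i => ∑' j, ((w : ℂ) ^ j) • a (i, j)) = 0 := by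
    intro w
    refine coeff_eq_zero_of_hasSum fun z => ?_
    have hz : HasSum (fun n : ℕ × ℕ => ((z : ℂ) ^ n.1 * (w : ℂ) ^ n.2) • a n) 0 := by
      have := (summable_powerSeries a (z, w)).hasSum
      have h0 : powerSeries a (z, w) = 0 := by rw [ha]; rfl
      change HasSum _ (powerSeries a (z, w)) at this
      rwa [h0] at this
    refine hz.prod_fiberwise fun i => ?_
    have := (hs w i).hasSum.const_smul ((z : ℂ) ^ i)
    simpa only [mul_smul] using this
  have h2 : ∀ i, (fun j => a (i, j)) = 0 := fun i =>
    coeff_eq_zero_of_hasSum fun w => by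
      have := (hs w i).hasSum
      rwa [show ∑' j, ((w : ℂ) ^ j) • a (i, j) = 0 from congrFun (h1 w) i] at this
  ext n
  exact congrFun (h2 n.1) n.2

variable (E)

/-- The functions on the bidisc which are sums of power series with square summable
coefficients in `E`. -/
def hardySubmodule : Submodule ℂ (UnitDisc × UnitDisc → E) :=
  LinearMap.range (powerSeries (E := E))

/-- The Hardy space `H²(𝔻²; E)` of `E`-valued functions on the bidisc. -/
def Hardy : Type u := hardySubmodule E

namespace Hardy

instance : AddCommGroup (Hardy E) := inferInstanceAs (AddCommGroup (hardySubmodule E))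

instance : Module ℂ (Hardy E) := inferInstanceAs (Module ℂ (hardySubmodule E))

instance : CoeFun (Hardy E) (fun _ => UnitDisc × UnitDisc → E) := ⟨fun f => f.1⟩

/-- A function in the Hardy space corresponds to its double sequence of Taylor coefficients. -/
def coeffEquiv : Hardy E ≃ₗ[ℂ] Coeff E :=
  (LinearEquiv.ofInjective (powerSeries (E := E)) powerSeries_injective).symm

/-- `‖f‖² = ∑ ‖a_{ij}‖²`, where `a` are the Taylor coefficients of `f`. -/
instance : NormedAddCommGroup (Hardy E) :=
  NormedAddCommGroup.induced (Hardy E) (Coeff E) (coeffEquiv E) (coeffEquiv E).injective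

/-- `⟪f, g⟫ = ∑ ⟪a_{ij}, b_{ij}⟫`, where `a` and `b` are the Taylor coefficients. -/
instance : InnerProductSpace ℂ (Hardy E) where
  toNormedSpace := NormedSpace.induced ℂ (Hardy E) (Coeff E) (coeffEquiv E)
  inner f g := inner ℂ (coeffEquiv E f) (coeffEquiv E g)
  norm_sq_eq_re_inner f := norm_sq_eq_re_inner (𝕜 := ℂ) (coeffEquiv E f)
  conj_inner_symm f g := inner_conj_symm (coeffEquiv E f) (coeffEquiv E g)
  add_left f g h := by rw [map_add, inner_add_left]
  smul_left f g r := by rw [map_smul, inner_smul_left]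

/-- The unitary from the Hardy space onto the space of Taylor coefficients. -/
def coeffIso : Hardy E ≃ₗᵢ[ℂ] Coeff E where
  toLinearEquiv := coeffEquiv E
  norm_map' _ := rfl

instance : CompleteSpace (Hardy E) :=
  (completeSpace_congr (e := (coeffIso E).toLinearEquiv.toEquiv)
    (coeffIso E).isometry.isUniformEmbedding).2 inferInstance

variable {E}

theorem ext {f g : Hardy E} (h : ∀ p, f p = g p) : f = g := Subtype.ext (funext h)

theorem apply_eq_tsum (f : Hardy E) (p : UnitDisc × UnitDisc) :
    f p = ∑' n : ℕ × ℕ, ((p.1 : ℂ) ^ n.1 * (p.2 : ℂ) ^ n.2) • coeffIso E f n := by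
  have h := (coeffEquiv E).symm_apply_apply f
  conv_lhs => rw [← h]
  rfl

/-- Reindexing of coefficients along an injective map, with zeros outside its range. -/
def reindex (g : ℕ × ℕ → ℕ × ℕ) (hg : Function.Injective g) (a : Coeff E) : Coeff E :=
  ⟨Function.extend g a 0, by
    have h2 : 0 < (2 : ENNReal).toReal := by norm_num
    refine (memℓp_gen_iff h2).2 ?_
    have h := (memℓp_gen_iff h2).1 (lp.memℓp a)
    refine (hg.summable_iff fun n hn => ?_).1 ?_
    · rw [Function.extend_apply' _ _ _ (by simpa using hn)]
      simp
    · simpa [Function.comp_def, hg.extend_apply] using h⟩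

theorem norm_reindex (g : ℕ × ℕ → ℕ × ℕ) (hg : Function.Injective g) (a : Coeff E) :
    ‖reindex g hg a‖ = ‖a‖ := by
  have h2 : 0 < (2 : ENNReal).toReal := by norm_num
  rw [lp.norm_eq_tsum_rpow h2, lp.norm_eq_tsum_rpow h2]
  congr 1
  rw [← hg.tsum_eq]
  · exact tsum_congr fun n => by simp [reindex, hg.extend_apply]
  · intro n hn
    by_contra hn'
    apply hn
    change ‖Function.extend g a 0 n‖ ^ _ = 0
    rw [Function.extend_apply' _ _ _ (by simpa using hn')]
    simp

theorem powerSeries_reindex (g : ℕ × ℕ → ℕ × ℕ) (hg : Function.Injective g)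
    (c : UnitDisc × UnitDisc → ℂ)
    (hc : ∀ p n, (p.1 : ℂ) ^ (g n).1 * (p.2 : ℂ) ^ (g n).2 =
      c p * ((p.1 : ℂ) ^ n.1 * (p.2 : ℂ) ^ n.2))
    (a : Coeff E) (p : UnitDisc × UnitDisc) :
    powerSeries (reindex g hg a) p = c p • powerSeries a p := by
  change ∑' n : ℕ × ℕ, _ • (Function.extend g a 0 n) = c p • ∑' n : ℕ × ℕ, _
  rw [← (summable_powerSeries a p).tsum_const_smul, ← hg.tsum_eq]
  · exact tsum_congr fun n => by rw [hg.extend_apply, hc, mul_smul]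
  · intro n hn
    by_contra hn'
    apply hn
    change _ • Function.extend g a 0 n = 0
    rw [Function.extend_apply' _ _ _ (by simpa using hn')]
    simp

/-- Multiplication by a function `c` on the bidisc, where multiplication by `c` takes
the monomial of index `n` to the monomial of index `g n`. -/
def mulOp (g : ℕ × ℕ → ℕ × ℕ) (hg : Function.Injective g)
    (c : UnitDisc × UnitDisc → ℂ)
    (hc : ∀ p n, (p.1 : ℂ) ^ (g n).1 * (p.2 : ℂ) ^ (g n).2 =
      c p * ((p.1 : ℂ) ^ n.1 * (p.2 : ℂ) ^ n.2)) : Hardy E →ₗᵢ[ℂ] Hardy E where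
  toFun f := ⟨fun p => c p • f p, reindex g hg (coeffIso E f), by
    funext p
    rw [powerSeries_reindex g hg c hc]
    congr 1
    exact (apply_eq_tsum f p).symm⟩
  map_add' f f' := ext fun p => smul_add (c p) (f p) (f' p)
  map_smul' r f := ext fun p => smul_comm (c p) r (f p)
  norm_map' f := by
    have h : ∀ x : Hardy E, ‖x‖ = ‖coeffIso E x‖ := fun x =>
      ((coeffIso E).norm_map x).symm
    rw [h f, ← norm_reindex g hg, h]
    congr 1
    apply powerSeries_injective
    funext p
    rw [powerSeries_reindex g hg c hc]
    refine (apply_eq_tsum _ p).symm.trans ?_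
    change c p • f p = c p • _
    congr 1
    exact apply_eq_tsum f p

variable (E)

/-- The operator `M_{z₁}` of multiplication by the first coordinate. -/
def M₁ : Hardy E →L[ℂ] Hardy E :=
  (mulOp (fun n => (n.1 + 1, n.2)) (fun a b h => by simpa [Prod.ext_iff] using h)
    (fun p => (p.1 : ℂ)) (fun p n => by ring)).toContinuousLinearMap

/-- The operator `M_{z₂}` of multiplication by the second coordinate. -/
def M₂ : Hardy E →L[ℂ] Hardy E :=
  (mulOp (fun n => (n.1, n.2 + 1)) (fun a b h => by simpa [Prod.ext_iff] using h)
    (fun p => (p.2 : ℂ)) (fun p n => by ring)).toContinuousLinearMap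

variable {E}

theorem M₁_apply (f : Hardy E) (p : UnitDisc × UnitDisc) : M₁ E f p = (p.1 : ℂ) • f p := rfl

theorem M₂_apply (f : Hardy E) (p : UnitDisc × UnitDisc) : M₂ E f p = (p.2 : ℂ) • f p := rfl

end Hardy

end Hardy

/-! ### Shift operators and `q`-commutativity -/

section Operators

open ContinuousLinearMap

variable {H : Type u} [NormedAddCommGroup H] [InnerProductSpace ℂ H] [CompleteSpace H]
variable {K : Type v} [NormedAddCommGroup K] [InnerProductSpace ℂ K] [CompleteSpace K]

/-- A shift operator: an isometry `V` with `V*ⁿ → 0` in the strong operator topology. -/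
def IsShift (V : H →L[ℂ] H) : Prop :=
  (∀ x, ‖V x‖ = ‖x‖) ∧ ∀ x, Tendsto (fun n : ℕ => (adjoint V ^ n) x) atTop (𝓝 0)

/-- `V₁ V₂ = q V₂ V₁`. -/
def IsQCommutative (q : ℂ) (V₁ V₂ : H →L[ℂ] H) : Prop :=
  V₁ * V₂ = q • (V₂ * V₁)

/-- `V₁ V₂ = q V₂ V₁` and `V₂ V₁* = q V₁* V₂`. -/
def IsDoublyQCommutative (q : ℂ) (V₁ V₂ : H →L[ℂ] H) : Prop :=
  IsQCommutative q V₁ V₂ ∧ V₂ * adjoint V₁ = q • (adjoint V₁ * V₂)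

/-- Joint unitary equivalence of the pairs `(V₁, V₂)` and `(W₁, W₂)`. -/
def PairUnitarilyEquivalent (V₁ V₂ : H →L[ℂ] H) (W₁ W₂ : K →L[ℂ] K) : Prop :=
  ∃ τ : H ≃ₗᵢ[ℂ] K, (∀ h, τ (V₁ h) = W₁ (τ h)) ∧ ∀ h, τ (V₂ h) = W₂ (τ h)

/-- `R` is the rotation by `q` along the shift `V`, that is,
`R h = D h + q V D V* h + q² V² D V*² h + ⋯`, where `D` is the defect operator of `V*`.
For an isometry `V`, the operator `1 - V V*` is a projection, so it equals its own positive
square root, which is `D`. -/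
def IsRotationAlong (q : ℂ) (V R : H →L[ℂ] H) : Prop :=
  ∀ h, HasSum (fun n : ℕ => q ^ n • (V ^ n) ((1 - V * adjoint V) ((adjoint V ^ n) h))) (R h)

/-- `(V₁, V₂)` is unitarily equivalent to `(M_{z₁} 𝔰_q, 𝔰_{q̄} M_{z₂})` on `H²(𝔻²; E)`, where
`𝔰_q` and `𝔰_{q̄}` are the unitaries which rotate by `q` and `q̄` along `M_{z₁} M_{z₂}`. -/
def HasTwistedHardyModel (q : ℂ) (V₁ V₂ : H →L[ℂ] H)
    (E : Type v) [NormedAddCommGroup E] [InnerProductSpace ℂ E] [CompleteSpace E] : Prop :=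
  ∃ s s' : Hardy E →L[ℂ] Hardy E,
    s ∈ unitary (Hardy E →L[ℂ] Hardy E) ∧ s' = star s ∧
    IsRotationAlong q (Hardy.M₁ E * Hardy.M₂ E) s ∧
    IsRotationAlong (conj q) (Hardy.M₁ E * Hardy.M₂ E) s' ∧
    PairUnitarilyEquivalent V₁ V₂ (Hardy.M₁ E * s) (s' * Hardy.M₂ E)

end Operators

end QShift

end

/-!
For a doubly `q`-commutative pair of shifts, `V₂` commutes with the projection `1 - V₁ V₁*`, so the
Wold decompositions of `V₁` and of `V₂` combine: `H` is the Hilbert sum of the spaces `V₁ⁱ V₂ʲ 𝒲`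
with `𝒲 = ker V₁* ∩ ker V₂*`. As `V₁ⁱ V₂ = qⁱ V₂ V₁ⁱ`, both operators act on this sum in a way that
depends on `q` only, and the pair is determined up to unitary equivalence by the Hilbert space `𝒲`.

The model is another such pair. Since `M = M_{z₁} M_{z₂}` moves monomials along the diagonals,
`𝔰_q` multiplies `z₁ⁱ z₂ʲ` by `q^min(i, j)`. It satisfies `𝔰_q M = q M 𝔰_q` and fixes `ker M*`,
which turns the double commutativity of `(M_{z₁}, M_{z₂})` into double `q`-commutativity of the
model. The model operators take constants to unimodular multiples of monomials, so the Hilbert sum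
of the translates of the constants is all of `H²(𝔻²; E)`, and the joint wandering subspace is `E`.
-/

namespace QShift

open ContinuousLinearMap

section HilbertSum

variable {𝕜 ι : Type*} [RCLike 𝕜] {G G' : ι → Type*}
  [∀ i, NormedAddCommGroup (G i)] [∀ i, InnerProductSpace 𝕜 (G i)]
  [∀ i, NormedAddCommGroup (G' i)] [∀ i, InnerProductSpace 𝕜 (G' i)]
  {H K F : Type*} [NormedAddCommGroup H] [InnerProductSpace 𝕜 H] [CompleteSpace H]
  [NormedAddCommGroup K] [InnerProductSpace 𝕜 K] [CompleteSpace K]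
  [NormedAddCommGroup F] [NormedSpace 𝕜 F]
  {V : ∀ i, G i →ₗᵢ[𝕜] H} {W : ∀ i, G i →ₗᵢ[𝕜] K}

theorem clm_ext_of_isHilbertSum (hV : IsHilbertSum 𝕜 G V) {A B : H →L[𝕜] F}
    (h : ∀ i a, A (V i a) = B (V i a)) : A = B := by
  ext x
  obtain ⟨f, rfl⟩ := hV.linearIsometryEquiv.symm.surjective x
  refine ((hV.hasSum_linearIsometryEquiv_symm f).mapL A).unique ?_
  simpa only [h] using! (hV.hasSum_linearIsometryEquiv_symm f).mapL B

theorem eq_zero_of_forall_inner_eq_zero (hV : IsHilbertSum 𝕜 G V) {x : H}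
    (h : ∀ i a, inner 𝕜 (V i a) x = 0) : x = 0 := by
  have hx : innerSL 𝕜 x = 0 := clm_ext_of_isHilbertSum hV fun i a => inner_eq_zero_symm.1 (h i a)
  exact inner_self_eq_zero.1 (congrArg (fun A : H →L[𝕜] 𝕜 => A x) hx)

theorem isHilbertSum_of_forall_inner_eq_zero [∀ i, CompleteSpace (G i)]
    (hV : OrthogonalFamily 𝕜 G V) (h : ∀ x, (∀ i a, inner 𝕜 (V i a) x = 0) → x = 0) :
    IsHilbertSum 𝕜 G V := by
  refine .mk hV (top_le_iff.2 ?_)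
  rw [Submodule.topologicalClosure_eq_top_iff, Submodule.eq_bot_iff]
  exact fun x hx => h x fun i a => (Submodule.mem_orthogonal _ _).1 hx _
    (Submodule.mem_iSup_of_mem i (LinearMap.mem_range_self _ a))

theorem isHilbertSum_comp_linearIsometryEquiv [∀ i, CompleteSpace (G' i)]
    (hV : IsHilbertSum 𝕜 G V) (e : ∀ i, G' i ≃ₗᵢ[𝕜] G i) :
    IsHilbertSum 𝕜 G' fun i => (V i).comp (e i).toLinearIsometry := by
  refine isHilbertSum_of_forall_inner_eq_zero
    (fun i j hij a b => hV.OrthogonalFamily hij (e i a) (e j b)) fun x hx => ?_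
  refine eq_zero_of_forall_inner_eq_zero hV fun i a => ?_
  simpa using hx i ((e i).symm a)

/-- The unitary between two Hilbert sums of the same family of spaces which identifies
corresponding summands. -/
noncomputable def hilbertSumEquiv (hV : IsHilbertSum 𝕜 G V) (hW : IsHilbertSum 𝕜 G W) :
    H ≃ₗᵢ[𝕜] K :=
  hV.linearIsometryEquiv.trans hW.linearIsometryEquiv.symm

theorem hilbertSumEquiv_apply (hV : IsHilbertSum 𝕜 G V) (hW : IsHilbertSum 𝕜 G W) (i : ι)
    (a : G i) : hilbertSumEquiv hV hW (V i a) = W i a := by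
  classical
  rw [hilbertSumEquiv, LinearIsometryEquiv.trans_apply,
    ← hV.linearIsometryEquiv_symm_apply_single, LinearIsometryEquiv.apply_symm_apply,
    hW.linearIsometryEquiv_symm_apply_single]

theorem hasSum_of_isHilbertSum (hV : IsHilbertSum 𝕜 G V) {κ : Type*} [DecidableEq κ] (k : ι → κ)
    {A : κ → H →L[𝕜] F} {R : H →L[𝕜] F}
    (h : ∀ n i a, A n (V i a) = if k i = n then R (V i a) else 0) (x : H) :
    HasSum (fun n => A n x) (R x) := by
  obtain ⟨f, rfl⟩ := hV.linearIsometryEquiv.symm.surjective x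
  have hf := hV.hasSum_linearIsometryEquiv_symm f
  refine ((Equiv.sigmaFiberEquiv k).hasSum_iff.2 (hf.mapL R)).sigma fun n => ?_
  refine (hasSum_subtype_iff_indicator (s := {i | k i = n})
    (f := fun i => R (V i (f i)))).2 ?_
  convert! hf.mapL (A n) using 1
  funext i
  rw [h, Set.indicator_apply]
  rfl

end HilbertSum

theorem nonempty_linearIsometryEquiv_self_iff_finrank_eq_one {𝕜 E : Type*} [RCLike 𝕜]
    [NormedAddCommGroup E] [InnerProductSpace 𝕜 E] :
    Nonempty (𝕜 ≃ₗᵢ[𝕜] E) ↔ Module.finrank 𝕜 E = 1 := by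
  refine ⟨fun ⟨φ⟩ => φ.toLinearEquiv.finrank_eq.symm.trans (Module.finrank_self 𝕜), fun h => ?_⟩
  have : FiniteDimensional 𝕜 E := Module.finite_of_finrank_pos (h ▸ one_pos)
  exact ⟨(stdOrthonormalBasis 𝕜 𝕜).equiv (stdOrthonormalBasis 𝕜 E)
    (finCongr (by rw [h, Module.finrank_self]))⟩

variable {H : Type u} [NormedAddCommGroup H] [InnerProductSpace ℂ H]
  {K : Type v} [NormedAddCommGroup K] [InnerProductSpace ℂ K]

section Isometry

variable {V : H →L[ℂ] H}

theorem norm_pow_apply (hV : ∀ x, ‖V x‖ = ‖x‖) (n : ℕ) (x : H) : ‖(V ^ n) x‖ = ‖x‖ := by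
  induction n with
  | zero => rfl
  | succ n ih => rw [pow_succ', mul_apply_eq_comp, hV, ih]

variable [CompleteSpace H]

theorem adjoint_apply_self (hV : ∀ x, ‖V x‖ = ‖x‖) (x : H) : adjoint V (V x) = x :=
  congrArg (fun A : H →L[ℂ] H => A x) ((norm_map_iff_adjoint_comp_self V).1 hV)

theorem adjoint_sub_apply_adjoint (hV : ∀ x, ‖V x‖ = ‖x‖) (x : H) :
    adjoint V (x - V (adjoint V x)) = 0 := by
  rw [map_sub, adjoint_apply_self hV, sub_self]

theorem adjoint_pow_apply_pow (hV : ∀ x, ‖V x‖ = ‖x‖) (n : ℕ) (x : H) :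
    (adjoint V ^ n) ((V ^ n) x) = x := by
  rw [← star_eq_adjoint, ← star_pow, star_eq_adjoint]
  exact adjoint_apply_self (norm_pow_apply hV n) x

theorem inner_pow_apply (V : H →L[ℂ] H) (n : ℕ) (x y : H) :
    inner ℂ ((V ^ n) x) y = inner ℂ x ((adjoint V ^ n) y) := by
  rw [← star_eq_adjoint, ← star_pow, star_eq_adjoint, adjoint_inner_right]

theorem inner_pow_pow (hV : ∀ x, ‖V x‖ = ‖x‖) (n : ℕ) (x y : H) :
    inner ℂ ((V ^ n) x) ((V ^ n) y) = inner ℂ x y := by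
  rw [inner_pow_apply, adjoint_pow_apply_pow hV]

theorem inner_pow_pow_of_lt (hV : ∀ x, ‖V x‖ = ‖x‖) {e : H} (he : adjoint V e = 0) {n m : ℕ}
    (h : n < m) (x : H) : inner ℂ ((V ^ n) e) ((V ^ m) x) = 0 := by
  obtain ⟨d, rfl⟩ := Nat.exists_eq_add_of_lt h
  rw [add_assoc, pow_add, mul_apply_eq_comp, inner_pow_pow hV, pow_succ', mul_apply_eq_comp,
    ← adjoint_inner_left, he, inner_zero_left]

theorem inner_pow_pow_of_ne (hV : ∀ x, ‖V x‖ = ‖x‖) {e e' : H} (he : adjoint V e = 0)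
    (he' : adjoint V e' = 0) {n m : ℕ} (h : n ≠ m) :
    inner ℂ ((V ^ n) e) ((V ^ m) e') = 0 := by
  rcases h.lt_or_gt with h | h
  · exact inner_pow_pow_of_lt hV he h e'
  · exact inner_eq_zero_symm.1 (inner_pow_pow_of_lt hV he' h e)

theorem inner_defect_left (V : H →L[ℂ] H) (x y : H) :
    inner ℂ ((1 - V * adjoint V) x) y = inner ℂ x ((1 - V * adjoint V) y) := by
  simp only [sub_apply, one_apply_eq_self, mul_apply_eq_comp, inner_sub_left, inner_sub_right]
  rw [← adjoint_inner_left, adjoint_inner_right]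

theorem IsShift.eq_zero_of_defect (hV : IsShift V) {x : H}
    (h : ∀ n : ℕ, (1 - V * adjoint V) ((adjoint V ^ n) x) = 0) : x = 0 := by
  have norm_eq (n : ℕ) : ‖(adjoint V ^ n) x‖ = ‖x‖ := by
    induction n with
    | zero => rfl
    | succ n ih =>
      have hn : (adjoint V ^ n) x = V (adjoint V ((adjoint V ^ n) x)) := sub_eq_zero.1 (h n)
      rw [← ih, pow_succ', mul_apply_eq_comp, ← hV.1, ← hn]
  have tendsto_zero := (hV.2 x).norm
  simp only [norm_eq, norm_zero] at tendsto_zero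
  exact norm_eq_zero.1 (tendsto_nhds_unique tendsto_const_nhds tendsto_zero)

theorem IsShift.eq_zero_of_inner (hV : IsShift V) {x : H}
    (h : ∀ n e, adjoint V e = 0 → inner ℂ ((V ^ n) e) x = 0) : x = 0 := by
  refine hV.eq_zero_of_defect fun n => ext_inner_left ℂ fun y => ?_
  rw [← inner_defect_left, ← inner_pow_apply, inner_zero_right]
  exact h n _ (adjoint_sub_apply_adjoint hV.1 y)

end Isometry

section Rotation

variable [CompleteSpace H] {V R : H →L[ℂ] H} {q : ℂ}

theorem wold_component_pow_apply (hV : ∀ x, ‖V x‖ = ‖x‖) {e : H} (he : adjoint V e = 0)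
    (n m : ℕ) :
    (V ^ n) ((1 - V * adjoint V) ((adjoint V ^ n) ((V ^ m) e))) =
      if m = n then (V ^ m) e else 0 := by
  rcases lt_trichotomy m n with h | rfl | h
  · obtain ⟨d, rfl⟩ := Nat.exists_eq_add_of_lt h
    have : (adjoint V ^ (m + d + 1)) ((V ^ m) e) = 0 := by
      rw [add_assoc, add_comm, pow_add, mul_apply_eq_comp, adjoint_pow_apply_pow hV, pow_succ,
        mul_apply_eq_comp, he, map_zero]
    rw [this, map_zero, map_zero, if_neg h.ne]
  · rw [adjoint_pow_apply_pow hV, if_pos rfl, sub_apply, mul_apply_eq_comp, he, map_zero, sub_zero,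
      one_apply_eq_self]
  · obtain ⟨d, rfl⟩ := Nat.exists_eq_add_of_lt h
    rw [add_assoc, pow_add, mul_apply_eq_comp, adjoint_pow_apply_pow hV, pow_succ',
      mul_apply_eq_comp, sub_apply, mul_apply_eq_comp, adjoint_apply_self hV, one_apply_eq_self,
      sub_self, map_zero, if_neg (by omega)]

theorem isRotationAlong_of_isHilbertSum {ι : Type*} {G : ι → Type*}
    [∀ i, NormedAddCommGroup (G i)] [∀ i, InnerProductSpace ℂ (G i)] {U : ∀ i, G i →ₗᵢ[ℂ] H}
    (hU : IsHilbertSum ℂ G U) (hV : ∀ x, ‖V x‖ = ‖x‖) (k : ι → ℕ)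
    (hk : ∀ i a, ∃ e, adjoint V e = 0 ∧ (V ^ k i) e = U i a)
    (hR : ∀ i a, R (U i a) = q ^ k i • U i a) : IsRotationAlong q V R := by
  let A (n : ℕ) : H →L[ℂ] H := q ^ n • (V ^ n * (1 - V * adjoint V) * adjoint V ^ n)
  have hA (n : ℕ) (i : ι) (a : G i) : A n (U i a) = if k i = n then R (U i a) else 0 := by
    obtain ⟨e, he, hUe⟩ := hk i a
    rw [hR, ← hUe, smul_apply, mul_apply_eq_comp, mul_apply_eq_comp,
      wold_component_pow_apply hV he]
    split_ifs with h
    · rw [h]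
    · rw [smul_zero]
  intro x
  have hsum := hasSum_of_isHilbertSum hU k hA x
  simpa only [A, smul_apply, mul_apply_eq_comp] using hsum

theorem IsRotationAlong.apply_of_adjoint_eq_zero (h : IsRotationAlong q V R)
    (hV : ∀ x, ‖V x‖ = ‖x‖) {e : H} (he : adjoint V e = 0) : R e = e := by
  refine (h e).unique ?_
  have term_eq (n : ℕ) : q ^ n • (V ^ n) ((1 - V * adjoint V) ((adjoint V ^ n) e)) =
      if n = 0 then e else 0 := by
    have wold := wold_component_pow_apply hV he n 0
    rw [pow_zero, one_apply_eq_self] at wold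
    rw [wold]
    rcases eq_or_ne n 0 with rfl | hn
    · simp
    · rw [if_neg hn.symm, if_neg hn, smul_zero]
  simpa only [term_eq] using hasSum_ite_eq 0 e

theorem IsRotationAlong.apply_apply (h : IsRotationAlong q V R) (hV : ∀ x, ‖V x‖ = ‖x‖) (x : H) :
    R (V x) = q • V (R x) := by
  have shifted := ((h x).mapL V).const_smul q
  refine (h (V x)).unique ((hasSum_nat_add_iff' 1).1 ?_)
  convert! shifted using 1
  · funext n
    rw [pow_succ (adjoint V), mul_apply_eq_comp, adjoint_apply_self hV, map_smul, smul_smul,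
      ← pow_succ', pow_succ' V, mul_apply_eq_comp]
  · simp [adjoint_apply_self hV]

theorem IsRotationAlong.unique {R' : H →L[ℂ] H} (h : IsRotationAlong q V R)
    (h' : IsRotationAlong q V R') : R = R' :=
  ContinuousLinearMap.ext fun x => (h x).unique (h' x)

end Rotation

section Wandering

variable {q : ℂ} {V₁ V₂ : H →L[ℂ] H}

theorem IsQCommutative.pow_apply (h : IsQCommutative q V₁ V₂) (n : ℕ) (x : H) :
    (V₁ ^ n) (V₂ x) = q ^ n • V₂ ((V₁ ^ n) x) := by
  induction n with
  | zero => simp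
  | succ n ih =>
    have h' (y : H) : V₁ (V₂ y) = q • V₂ (V₁ y) := congrArg (fun A : H →L[ℂ] H => A y) h
    rw [pow_succ', mul_apply_eq_comp, ih, map_smul, h', smul_smul, ← pow_succ, mul_apply_eq_comp]

variable {E : Type*} [NormedAddCommGroup E] [InnerProductSpace ℂ E]

/-- The embedding `a ↦ V₁ⁱ V₂ʲ (φ a)`, where `n = (i, j)`, for isometries `V₁` and `V₂`. -/
noncomputable def translate (h₁ : ∀ x, ‖V₁ x‖ = ‖x‖) (h₂ : ∀ x, ‖V₂ x‖ = ‖x‖) (φ : E →ₗᵢ[ℂ] H)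
    (n : ℕ × ℕ) : E →ₗᵢ[ℂ] H where
  toLinearMap := (V₁ ^ n.1 * V₂ ^ n.2).toLinearMap ∘ₗ φ.toLinearMap
  norm_map' a := by
    change ‖(V₁ ^ n.1) ((V₂ ^ n.2) (φ a))‖ = ‖a‖
    rw [norm_pow_apply h₁, norm_pow_apply h₂, φ.norm_map]

variable {h₁ : ∀ x, ‖V₁ x‖ = ‖x‖} {h₂ : ∀ x, ‖V₂ x‖ = ‖x‖} {φ : E →ₗᵢ[ℂ] H}

theorem translate_apply (n : ℕ × ℕ) (a : E) :
    translate h₁ h₂ φ n a = (V₁ ^ n.1) ((V₂ ^ n.2) (φ a)) := rfl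

theorem translate_succ_left (i j : ℕ) (a : E) :
    translate h₁ h₂ φ (i + 1, j) a = V₁ (translate h₁ h₂ φ (i, j) a) := by
  rw [translate_apply, pow_succ', mul_apply_eq_comp, translate_apply]

theorem IsQCommutative.translate_succ_right (h : IsQCommutative q V₁ V₂) (i j : ℕ) (a : E) :
    translate h₁ h₂ φ (i, j + 1) a = q ^ i • V₂ (translate h₁ h₂ φ (i, j) a) := by
  rw [translate_apply, pow_succ', mul_apply_eq_comp, h.pow_apply, translate_apply]

variable [CompleteSpace H]

theorem IsDoublyQCommutative.adjoint_apply_eq_zero (h : IsDoublyQCommutative q V₁ V₂)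
    (hq : q ≠ 0) {e : H} (he : adjoint V₁ e = 0) : adjoint V₁ (V₂ e) = 0 := by
  have h' : V₂ (adjoint V₁ e) = q • adjoint V₁ (V₂ e) :=
    congrArg (fun A : H →L[ℂ] H => A e) h.2
  rw [he, map_zero, eq_comm, smul_eq_zero] at h'
  exact h'.resolve_left hq

theorem IsDoublyQCommutative.adjoint_pow_apply_eq_zero (h : IsDoublyQCommutative q V₁ V₂)
    (hq : q ≠ 0) {e : H} (he : adjoint V₁ e = 0) (n : ℕ) : adjoint V₁ ((V₂ ^ n) e) = 0 := by
  induction n with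
  | zero => exact he
  | succ n ih =>
    rw [pow_succ', mul_apply_eq_comp]
    exact h.adjoint_apply_eq_zero hq ih

theorem IsDoublyQCommutative.commute_defect (h : IsDoublyQCommutative q V₁ V₂) (hq : q ≠ 0) :
    Commute V₂ (1 - V₁ * adjoint V₁) := by
  refine (Commute.one_right _).sub_right (smul_right_injective _ hq ?_)
  calc q • (V₂ * (V₁ * adjoint V₁)) = V₁ * V₂ * adjoint V₁ := by
        rw [h.1, smul_mul_assoc, mul_assoc]
    _ = q • (V₁ * adjoint V₁ * V₂) := by rw [mul_assoc, h.2, mul_smul_comm, mul_assoc]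

theorem IsDoublyQCommutative.commute_adjoint_defect (h : IsDoublyQCommutative q V₁ V₂)
    (hq : q ≠ 0) : Commute (adjoint V₂) (1 - V₁ * adjoint V₁) := by
  simpa [← star_eq_adjoint] using (h.commute_defect hq).star_star

/-- The joint wandering subspace `ker V₁* ∩ ker V₂*`. -/
noncomputable abbrev wandering (V₁ V₂ : H →L[ℂ] H) : Submodule ℂ H :=
  LinearMap.ker (adjoint V₁).toLinearMap ⊓ LinearMap.ker (adjoint V₂).toLinearMap

theorem mem_wandering {x : H} : x ∈ wandering V₁ V₂ ↔ adjoint V₁ x = 0 ∧ adjoint V₂ x = 0 :=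
  Iff.rfl

instance (V₁ V₂ : H →L[ℂ] H) : CompleteSpace (wandering V₁ V₂) :=
  ((adjoint V₁).isClosed_ker.inter (adjoint V₂).isClosed_ker).completeSpace_coe

theorem IsDoublyQCommutative.defect_mem_wandering (h : IsDoublyQCommutative q V₁ V₂) (hq : q ≠ 0)
    (h₁ : ∀ x, ‖V₁ x‖ = ‖x‖) {e : H} (he : adjoint V₂ e = 0) :
    (1 - V₁ * adjoint V₁) e ∈ wandering V₁ V₂ := by
  refine mem_wandering.2 ⟨adjoint_sub_apply_adjoint h₁ e, ?_⟩
  rw [← mul_apply_eq_comp, (h.commute_adjoint_defect hq).eq, mul_apply_eq_comp, he, map_zero]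

theorem IsDoublyQCommutative.isHilbertSum_translate [CompleteSpace E]
    (h : IsDoublyQCommutative q V₁ V₂) (hq : q ≠ 0) (h₁ : IsShift V₁) (h₂ : IsShift V₂)
    (φ : E ≃ₗᵢ[ℂ] wandering V₁ V₂) :
    IsHilbertSum ℂ (fun _ => E)
      (translate h₁.1 h₂.1 ((wandering V₁ V₂).subtypeₗᵢ.comp φ.toLinearIsometry)) := by
  refine isHilbertSum_of_forall_inner_eq_zero (fun ⟨i, j⟩ ⟨k, l⟩ hn a b => ?_) fun x hx => ?_
  · obtain ⟨ha₁, ha₂⟩ := mem_wandering.1 (φ a).2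
    obtain ⟨hb₁, hb₂⟩ := mem_wandering.1 (φ b).2
    change inner ℂ ((V₁ ^ i) ((V₂ ^ j) (φ a : H))) ((V₁ ^ k) ((V₂ ^ l) (φ b : H))) = 0
    rcases ne_or_eq i k with hik | rfl
    · exact inner_pow_pow_of_ne h₁.1 (h.adjoint_pow_apply_eq_zero hq ha₁ j)
        (h.adjoint_pow_apply_eq_zero hq hb₁ l) hik
    · rw [inner_pow_pow h₁.1]
      exact inner_pow_pow_of_ne h₂.1 ha₂ hb₂ fun hjl => hn (by rw [hjl])
  · refine h₁.eq_zero_of_defect fun i => h₂.eq_zero_of_inner fun j e he => ?_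
    rw [← inner_defect_left, ← inner_pow_apply, ← mul_apply_eq_comp (1 - _),
      ← ((h.commute_defect hq).pow_left j).eq, mul_apply_eq_comp]
    have hxe := hx (i, j) (φ.symm ⟨_, h.defect_mem_wandering hq h₁.1 he⟩)
    change inner ℂ ((V₁ ^ i) ((V₂ ^ j) (φ (φ.symm _) : H))) x = 0 at hxe
    rwa [φ.apply_symm_apply] at hxe

theorem inner_translate_of_mem_wandering (h : IsQCommutative q V₁ V₂) {x : H}
    (hx : x ∈ wandering V₁ V₂) {n : ℕ × ℕ} (hn : n ≠ 0) (a : E) :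
    inner ℂ (translate h₁ h₂ φ n a) x = 0 := by
  obtain ⟨hx₁, hx₂⟩ := mem_wandering.1 hx
  match n with
  | (i + 1, j) => rw [translate_succ_left, ← adjoint_inner_right, hx₁, inner_zero_right]
  | (0, j + 1) =>
    rw [h.translate_succ_right, pow_zero, one_smul, ← adjoint_inner_right, hx₂, inner_zero_right]
  | (0, 0) => exact absurd rfl hn

theorem range_eq_wandering_of_isHilbertSum_translate [CompleteSpace E] (hq : q ≠ 0)
    (h : IsQCommutative q V₁ V₂) (hφ : IsHilbertSum ℂ (fun _ => E) (translate h₁ h₂ φ)) :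
    LinearMap.range φ.toLinearMap = wandering V₁ V₂ := by
  have orthogonal {n : ℕ × ℕ} (hn : n ≠ 0) (a b : E) :
      inner ℂ (translate h₁ h₂ φ n b) (φ a) = 0 :=
    hφ.OrthogonalFamily (j := 0) hn b a
  have range_le (a : E) : φ a ∈ wandering V₁ V₂ := by
    refine mem_wandering.2 ⟨?_, ?_⟩ <;>
      refine eq_zero_of_forall_inner_eq_zero hφ fun ⟨i, j⟩ b => ?_
    · rw [adjoint_inner_right, ← translate_succ_left]
      exact orthogonal (by simp) a b
    · have := orthogonal (n := (i, j + 1)) (by simp) a b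
      rw [h.translate_succ_right, inner_smul_left, mul_eq_zero] at this
      rw [adjoint_inner_right]
      exact this.resolve_left (by simp [hq])
  refine le_antisymm (fun _ ⟨a, ha⟩ => ha ▸ range_le a) fun x hx => ?_
  let P : H →L[ℂ] E := adjoint φ.toContinuousLinearMap
  have hφP : x - φ (P x) = 0 := by
    refine eq_zero_of_forall_inner_eq_zero hφ fun n b => ?_
    rcases ne_or_eq n 0 with hn | rfl
    · exact inner_translate_of_mem_wandering h (sub_mem hx (range_le (P x))) hn b
    · change inner ℂ (φ b) (x - φ (P x)) = 0
      rw [inner_sub_right, φ.inner_map_map, sub_eq_zero]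
      exact (adjoint_inner_right φ.toContinuousLinearMap b x).symm
  exact ⟨P x, (sub_eq_zero.1 hφP).symm⟩

theorem pairUnitarilyEquivalent_of_isHilbertSum_translate [CompleteSpace K] {W₁ W₂ : K →L[ℂ] K}
    {k₁ : ∀ x, ‖W₁ x‖ = ‖x‖} {k₂ : ∀ x, ‖W₂ x‖ = ‖x‖} {ψ : E →ₗᵢ[ℂ] K} (hq : q ≠ 0)
    (hV : IsQCommutative q V₁ V₂) (hW : IsQCommutative q W₁ W₂)
    (hφ : IsHilbertSum ℂ (fun _ => E) (translate h₁ h₂ φ))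
    (hψ : IsHilbertSum ℂ (fun _ => E) (translate k₁ k₂ ψ)) :
    PairUnitarilyEquivalent V₁ V₂ W₁ W₂ := by
  let τ := hilbertSumEquiv hφ hψ
  let T : H →L[ℂ] K := τ.toContinuousLinearEquiv
  have hT (n : ℕ × ℕ) (a : E) : T (translate h₁ h₂ φ n a) = translate k₁ k₂ ψ n a :=
    hilbertSumEquiv_apply hφ hψ n a
  have hT₁ : T ∘L V₁ = W₁ ∘L T := clm_ext_of_isHilbertSum hφ fun ⟨i, j⟩ a => by
    rw [comp_apply, comp_apply, ← translate_succ_left, hT, hT, translate_succ_left]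
  have hT₂ : T ∘L V₂ = W₂ ∘L T := clm_ext_of_isHilbertSum hφ fun ⟨i, j⟩ a => by
    refine smul_right_injective K (pow_ne_zero i hq) ?_
    simp only [comp_apply]
    rw [← map_smul, ← hV.translate_succ_right, hT, hT, hW.translate_succ_right]
  exact ⟨τ, fun x => congrArg (fun A : H →L[ℂ] K => A x) hT₁,
    fun x => congrArg (fun A : H →L[ℂ] K => A x) hT₂⟩

end Wandering

section Twist

variable [CompleteSpace H] {q : ℂ} {W₁ W₂ s : H →L[ℂ] H}

theorem IsRotationAlong.star_apply_of_adjoint_eq_zero {V : H →L[ℂ] H} (h : IsRotationAlong q V s)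
    (hs : s ∈ unitary (H →L[ℂ] H)) (hV : ∀ x, ‖V x‖ = ‖x‖) {e : H} (he : adjoint V e = 0) :
    star s e = e := by
  have hse : s e = e := h.apply_of_adjoint_eq_zero hV he
  calc star s e = (star s * s) e := by rw [mul_apply_eq_comp, hse]
    _ = e := by rw [Unitary.star_mul_self_of_mem hs, one_apply_eq_self]

theorem IsRotationAlong.smul_star_apply_apply {V : H →L[ℂ] H} (h : IsRotationAlong q V s)
    (hs : s ∈ unitary (H →L[ℂ] H)) (hV : ∀ x, ‖V x‖ = ‖x‖) (x : H) :
    q • star s (V x) = V (star s x) := by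
  have star_self (y : H) : star s (s y) = y := by
    rw [← mul_apply_eq_comp, Unitary.star_mul_self_of_mem hs, one_apply_eq_self]
  have self_star (y : H) : s (star s y) = y := by
    rw [← mul_apply_eq_comp, Unitary.mul_star_self_of_mem hs, one_apply_eq_self]
  rw [← star_self (V (star s x)), h.apply_apply hV, self_star, map_smul]

theorem IsDoublyQCommutative.twist (h : IsDoublyQCommutative 1 W₁ W₂) (h₁ : ∀ x, ‖W₁ x‖ = ‖x‖)
    (h₂ : ∀ x, ‖W₂ x‖ = ‖x‖) (hs : s ∈ unitary (H →L[ℂ] H))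
    (hrot : IsRotationAlong q (W₁ * W₂) s) : IsDoublyQCommutative q (W₁ * s) (star s * W₂) := by
  have hM (x : H) : ‖(W₁ * W₂) x‖ = ‖x‖ := by rw [mul_apply_eq_comp, h₁, h₂]
  have comm : W₁ * W₂ = W₂ * W₁ := h.1.trans (one_smul ℂ _)
  constructor
  · calc W₁ * s * (star s * W₂) = W₁ * (s * star s) * W₂ := by simp only [mul_assoc]
      _ = star s * s * (W₁ * W₂) := by
        rw [Unitary.mul_star_self_of_mem hs, Unitary.star_mul_self_of_mem hs, mul_one, one_mul]
      _ = star s * (q • (W₁ * W₂ * s)) := by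
        rw [mul_assoc]
        exact congrArg _ (ContinuousLinearMap.ext (hrot.apply_apply hM))
      _ = q • (star s * W₂ * (W₁ * s)) := by rw [comm, mul_smul_comm]; simp only [mul_assoc]
  have key (x : H) : W₂ (star s (adjoint W₁ x)) = q • adjoint W₁ (star s (W₂ x)) := by
    set d := x - W₁ (adjoint W₁ x) with hd
    have hd₁ : adjoint W₁ d = 0 := adjoint_sub_apply_adjoint h₁ x
    have hd₂ : adjoint W₁ (W₂ d) = 0 := h.adjoint_apply_eq_zero one_ne_zero hd₁
    have fixed : star s (W₂ d) = W₂ d := by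
      refine hrot.star_apply_of_adjoint_eq_zero hs hM ?_
      rw [← star_eq_adjoint, star_mul, mul_apply_eq_comp, star_eq_adjoint, star_eq_adjoint, hd₂,
        map_zero]
    have on_range (y : H) : q • adjoint W₁ (star s (W₂ (W₁ y))) = W₂ (star s y) := by
      rw [← mul_apply_eq_comp W₂, ← comm, ← map_smul, hrot.smul_star_apply_apply hs hM,
        mul_apply_eq_comp, adjoint_apply_self h₁]
    rw [← sub_add_cancel x (W₁ (adjoint W₁ x)), ← hd]
    simp only [map_add, smul_add, hd₁, fixed, hd₂, on_range, adjoint_apply_self h₁, map_zero,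
      smul_zero]
  ext x
  simpa [← star_eq_adjoint, mul_assoc] using congrArg (fun y => star s y) (key x)

end Twist

namespace Hardy

variable {E : Type u} [NormedAddCommGroup E] [InnerProductSpace ℂ E] [CompleteSpace E]

/-- The embedding `a ↦ z₁ⁱ z₂ʲ a` of the coefficient space, where `n = (i, j)`. -/
noncomputable def monomial (n : ℕ × ℕ) : E →ₗᵢ[ℂ] Hardy E :=
  (coeffIso E).symm.toLinearIsometry.comp
    { toLinearMap := lp.lsingle (E := fun _ => E) 2 n
      norm_map' a := lp.norm_single (E := fun _ => E) (by norm_num) n a }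

theorem coeffIso_monomial (n : ℕ × ℕ) (a : E) : coeffIso E (monomial n a) = lp.single 2 n a :=
  (coeffIso E).apply_symm_apply (lp.single 2 n a)

theorem inner_monomial_left (n : ℕ × ℕ) (a : E) (f : Hardy E) :
    inner ℂ (monomial n a) f = inner ℂ a (coeffIso E f n) := by
  rw [← (coeffIso E).inner_map_map, coeffIso_monomial, lp.inner_single_left]

theorem isHilbertSum_monomial : IsHilbertSum ℂ (fun _ => E) (monomial (E := E)) := by
  refine isHilbertSum_of_forall_inner_eq_zero (fun n m hnm a b => ?_) fun f hf => ?_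
  · rw [inner_monomial_left, coeffIso_monomial, lp.single_apply_ne _ _ _ hnm, inner_zero_right]
  · refine (map_eq_zero_iff _ (coeffIso E).injective).1 (lp.ext (funext fun n => ?_))
    exact ext_inner_left ℂ fun a => by
      rw [← inner_monomial_left, hf, lp.coeFn_zero, Pi.zero_apply, inner_zero_right]

theorem monomial_apply (n : ℕ × ℕ) (a : E) (p : Complex.UnitDisc × Complex.UnitDisc) :
    monomial n a p = ((p.1 : ℂ) ^ n.1 * (p.2 : ℂ) ^ n.2) • a := by
  rw [apply_eq_tsum, coeffIso_monomial, tsum_eq_single n, lp.single_apply_self]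
  intro m hm
  rw [lp.single_apply_ne _ _ _ hm, smul_zero]

theorem M₁_monomial (i j : ℕ) (a : E) : M₁ E (monomial (i, j) a) = monomial (i + 1, j) a :=
  ext fun p => by rw [M₁_apply, monomial_apply, monomial_apply, smul_smul, pow_succ', mul_assoc]

theorem M₂_monomial (i j : ℕ) (a : E) : M₂ E (monomial (i, j) a) = monomial (i, j + 1) a :=
  ext fun p => by
    rw [M₂_apply, monomial_apply, monomial_apply, smul_smul, pow_succ', mul_left_comm]

theorem norm_M₁_apply (f : Hardy E) : ‖M₁ E f‖ = ‖f‖ := LinearIsometry.norm_map _ f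

theorem norm_M₂_apply (f : Hardy E) : ‖M₂ E f‖ = ‖f‖ := LinearIsometry.norm_map _ f

theorem adjoint_M₁_monomial_zero (j : ℕ) (a : E) : adjoint (M₁ E) (monomial (0, j) a) = 0 :=
  eq_zero_of_forall_inner_eq_zero isHilbertSum_monomial fun ⟨i, k⟩ b => by
    rw [adjoint_inner_right, M₁_monomial]
    exact isHilbertSum_monomial.OrthogonalFamily (by simp) b a

theorem adjoint_M₂_monomial_zero (i : ℕ) (a : E) : adjoint (M₂ E) (monomial (i, 0) a) = 0 :=
  eq_zero_of_forall_inner_eq_zero isHilbertSum_monomial fun ⟨k, j⟩ b => by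
    rw [adjoint_inner_right, M₂_monomial]
    exact isHilbertSum_monomial.OrthogonalFamily (by simp) b a

theorem M₁_mul_M₂ : M₁ E * M₂ E = M₂ E * M₁ E :=
  ContinuousLinearMap.ext fun f => ext fun p => smul_comm (p.1 : ℂ) (p.2 : ℂ) (f p)

theorem isDoublyQCommutative_M₁_M₂ : IsDoublyQCommutative 1 (M₁ E) (M₂ E) := by
  refine ⟨by rw [IsQCommutative, one_smul, M₁_mul_M₂], ?_⟩
  rw [one_smul]
  refine clm_ext_of_isHilbertSum isHilbertSum_monomial fun ⟨i, j⟩ a => ?_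
  rw [mul_apply_eq_comp, mul_apply_eq_comp, M₂_monomial]
  cases i with
  | zero => rw [adjoint_M₁_monomial_zero, adjoint_M₁_monomial_zero, map_zero]
  | succ i =>
    rw [← M₁_monomial, ← M₁_monomial, adjoint_apply_self norm_M₁_apply,
      adjoint_apply_self norm_M₁_apply, M₂_monomial]

theorem norm_M₁_mul_M₂_apply (f : Hardy E) : ‖(M₁ E * M₂ E) f‖ = ‖f‖ := by
  rw [mul_apply_eq_comp, norm_M₁_apply, norm_M₂_apply]

theorem M₁_mul_M₂_pow_monomial (k i j : ℕ) (a : E) :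
    ((M₁ E * M₂ E) ^ k) (monomial (i, j) a) = monomial (i + k, j + k) a := by
  induction k with
  | zero => rfl
  | succ k ih =>
    rw [pow_succ', mul_apply_eq_comp, ih, mul_apply_eq_comp, M₂_monomial, M₁_monomial,
      add_assoc, add_assoc]

theorem adjoint_M₁_mul_M₂_monomial {i j : ℕ} (h : i = 0 ∨ j = 0) (a : E) :
    adjoint (M₁ E * M₂ E) (monomial (i, j) a) = 0 := by
  rcases h with rfl | rfl
  · rw [← star_eq_adjoint, star_mul, mul_apply_eq_comp, star_eq_adjoint, star_eq_adjoint,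
      adjoint_M₁_monomial_zero, map_zero]
  · rw [M₁_mul_M₂, ← star_eq_adjoint, star_mul, mul_apply_eq_comp, star_eq_adjoint,
      star_eq_adjoint, adjoint_M₂_monomial_zero, map_zero]

variable (E) in
/-- The unitary `𝔰_q`, constructed as the diagonal operator
`z₁ⁱ z₂ʲ a ↦ q^min(i, j) z₁ⁱ z₂ʲ a`. -/
noncomputable def rotation (q : unitary ℂ) : unitary (Hardy E →L[ℂ] Hardy E) :=
  Unitary.linearIsometryEquiv.symm <| hilbertSumEquiv isHilbertSum_monomial <|
    isHilbertSum_comp_linearIsometryEquiv isHilbertSum_monomial fun n =>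
      q ^ min n.1 n.2 • LinearIsometryEquiv.refl ℂ E

theorem rotation_monomial (q : unitary ℂ) (n : ℕ × ℕ) (a : E) :
    (rotation E q : Hardy E →L[ℂ] Hardy E) (monomial n a) =
      (q : ℂ) ^ min n.1 n.2 • monomial n a := by
  rw [rotation, Unitary.coe_symm_linearIsometryEquiv_apply]
  change hilbertSumEquiv _ _ (monomial n a) = _
  rw [hilbertSumEquiv_apply]
  simp

theorem star_rotation (q : unitary ℂ) :
    star (rotation E q) = rotation E (star q) := by
  rw [Unitary.star_eq_inv, inv_eq_iff_mul_eq_one]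
  refine Subtype.ext (clm_ext_of_isHilbertSum isHilbertSum_monomial fun n a => ?_)
  rw [Submonoid.coe_mul, mul_apply_eq_comp, rotation_monomial, map_smul, rotation_monomial,
    smul_smul, ← mul_pow, ← Submonoid.coe_mul, Unitary.star_mul_self]
  simp

theorem isRotationAlong_rotation (q : unitary ℂ) :
    IsRotationAlong q (M₁ E * M₂ E) (rotation E q) := by
  refine isRotationAlong_of_isHilbertSum isHilbertSum_monomial norm_M₁_mul_M₂_apply
    (fun n => min n.1 n.2) (fun ⟨i, j⟩ a => ?_) (rotation_monomial q)
  refine ⟨monomial (i - min i j, j - min i j) a, adjoint_M₁_mul_M₂_monomial (by omega) a, ?_⟩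
  rw [M₁_mul_M₂_pow_monomial, Nat.sub_add_cancel (min_le_left i j),
    Nat.sub_add_cancel (min_le_right i j)]

variable (E) in
/-- The first operator `M_{z₁} 𝔰_q` of the model pair. -/
noncomputable abbrev twistedM₁ (q : unitary ℂ) : Hardy E →L[ℂ] Hardy E := M₁ E * rotation E q

variable (E) in
/-- The second operator `𝔰_{q̄} M_{z₂}` of the model pair. -/
noncomputable abbrev twistedM₂ (q : unitary ℂ) : Hardy E →L[ℂ] Hardy E :=
  star (rotation E q : Hardy E →L[ℂ] Hardy E) * M₂ E

theorem isDoublyQCommutative_twistedM (q : unitary ℂ) :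
    IsDoublyQCommutative q (twistedM₁ E q) (twistedM₂ E q) :=
  isDoublyQCommutative_M₁_M₂.twist norm_M₁_apply norm_M₂_apply (rotation E q).2
    (isRotationAlong_rotation q)

theorem norm_twistedM₁_apply (q : unitary ℂ) (f : Hardy E) : ‖twistedM₁ E q f‖ = ‖f‖ := by
  rw [mul_apply_eq_comp, norm_M₁_apply, Unitary.norm_map]

theorem norm_twistedM₂_apply (q : unitary ℂ) (f : Hardy E) : ‖twistedM₂ E q f‖ = ‖f‖ := by
  rw [mul_apply_eq_comp, ← Unitary.coe_star, Unitary.norm_map, norm_M₂_apply]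

theorem twistedM₂_pow_monomial_zero (q : unitary ℂ) (j : ℕ) (a : E) :
    (twistedM₂ E q ^ j) (monomial 0 a) = monomial (0, j) a := by
  induction j with
  | zero => rfl
  | succ j ih =>
    rw [pow_succ', mul_apply_eq_comp, ih, mul_apply_eq_comp, M₂_monomial, ← Unitary.coe_star,
      star_rotation, rotation_monomial, Nat.zero_min, pow_zero, one_smul]

theorem twistedM₁_pow_monomial (q : unitary ℂ) (i j : ℕ) (a : E) :
    (twistedM₁ E q ^ i) (monomial (0, j) a) =
      (∏ k ∈ Finset.range i, (q : ℂ) ^ min k j) • monomial (i, j) a := by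
  induction i with
  | zero => simp
  | succ i ih =>
    rw [pow_succ', mul_apply_eq_comp, ih, map_smul, mul_apply_eq_comp, rotation_monomial, map_smul,
      M₁_monomial, smul_smul, Finset.prod_range_succ]

theorem isHilbertSum_translate_twistedM (q : unitary ℂ) :
    IsHilbertSum ℂ (fun _ => E)
      (translate (norm_twistedM₁_apply q) (norm_twistedM₂_apply q) (monomial (E := E) 0)) := by
  convert! isHilbertSum_comp_linearIsometryEquiv isHilbertSum_monomial fun n : ℕ × ℕ =>
    (∏ k ∈ Finset.range n.1, q ^ min k n.2) • LinearIsometryEquiv.refl ℂ E using 1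
  ext n a
  rw [translate_apply, twistedM₂_pow_monomial_zero, twistedM₁_pow_monomial]
  simp

theorem nonempty_equiv_wandering_twistedM (q : unitary ℂ) :
    Nonempty (E ≃ₗᵢ[ℂ] wandering (twistedM₁ E q) (twistedM₂ E q)) :=
  have range_eq := range_eq_wandering_of_isHilbertSum_translate (Unitary.toUnits q).ne_zero
    (isDoublyQCommutative_twistedM q).1 (isHilbertSum_translate_twistedM q)
  ⟨(monomial 0).equivRange.trans (.ofEq _ _ range_eq)⟩

end Hardy

section Transport

variable [CompleteSpace H] [CompleteSpace K]

theorem adjoint_intertwines {V : H →L[ℂ] H} {W : K →L[ℂ] K} {τ : H ≃ₗᵢ[ℂ] K}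
    (h : ∀ x, τ (V x) = W (τ x)) (x : H) : τ (adjoint V x) = adjoint W (τ x) := by
  refine ext_inner_left ℂ fun y => ?_
  obtain ⟨y, rfl⟩ := τ.surjective y
  rw [τ.inner_map_map, adjoint_inner_right, adjoint_inner_right, ← h, τ.inner_map_map]

variable {q : ℂ} {V₁ V₂ : H →L[ℂ] H} {W₁ W₂ : K →L[ℂ] K}

theorem PairUnitarilyEquivalent.isDoublyQCommutative (h : PairUnitarilyEquivalent V₁ V₂ W₁ W₂)
    (hW : IsDoublyQCommutative q W₁ W₂) : IsDoublyQCommutative q V₁ V₂ := by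
  obtain ⟨τ, hτ₁, hτ₂⟩ := h
  refine ⟨ContinuousLinearMap.ext fun x => τ.injective ?_,
    ContinuousLinearMap.ext fun x => τ.injective ?_⟩
  · simpa [hτ₁, hτ₂] using congrArg (fun A : K →L[ℂ] K => A (τ x)) hW.1
  · simpa [hτ₁, hτ₂, adjoint_intertwines hτ₁] using
      congrArg (fun A : K →L[ℂ] K => A (τ x)) hW.2

theorem PairUnitarilyEquivalent.nonempty_wandering_equiv
    (h : PairUnitarilyEquivalent V₁ V₂ W₁ W₂) :
    Nonempty (wandering V₁ V₂ ≃ₗᵢ[ℂ] wandering W₁ W₂) := by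
  obtain ⟨τ, hτ₁, hτ₂⟩ := h
  have mem_iff (x : H) : τ x ∈ wandering W₁ W₂ ↔ x ∈ wandering V₁ V₂ := by
    rw [mem_wandering, mem_wandering, ← adjoint_intertwines hτ₁, ← adjoint_intertwines hτ₂,
      map_eq_zero_iff _ τ.injective, map_eq_zero_iff _ τ.injective]
  have map_eq : (wandering V₁ V₂).map τ.toLinearEquiv.toLinearMap = wandering W₁ W₂ := by
    ext y
    obtain ⟨x, rfl⟩ := τ.surjective y
    rw [mem_iff]
    exact τ.injective.mem_set_image
  exact ⟨(τ.submoduleMap _).trans (.ofEq _ _ map_eq)⟩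

end Transport

section Model

variable {q : unitary ℂ} {V₁ V₂ : H →L[ℂ] H} {E : Type v}
  [NormedAddCommGroup E] [InnerProductSpace ℂ E] [CompleteSpace E]

theorem hasTwistedHardyModel_iff_pairUnitarilyEquivalent :
    HasTwistedHardyModel q V₁ V₂ E ↔
      PairUnitarilyEquivalent V₁ V₂ (Hardy.twistedM₁ E q) (Hardy.twistedM₂ E q) := by
  constructor
  · rintro ⟨s, _, -, rfl, hs, -, h⟩
    rwa [hs.unique (Hardy.isRotationAlong_rotation q)] at h
  · refine fun h => ⟨_, _, (Hardy.rotation E q).2, rfl, Hardy.isRotationAlong_rotation q, ?_, h⟩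
    rw [← Unitary.coe_star, Hardy.star_rotation]
    exact Hardy.isRotationAlong_rotation (star q)

theorem hasTwistedHardyModel_iff [CompleteSpace H] (h₁ : IsShift V₁) (h₂ : IsShift V₂) :
    HasTwistedHardyModel q V₁ V₂ E ↔
      IsDoublyQCommutative q V₁ V₂ ∧ Nonempty (E ≃ₗᵢ[ℂ] wandering V₁ V₂) := by
  rw [hasTwistedHardyModel_iff_pairUnitarilyEquivalent]
  constructor
  · intro h
    obtain ⟨φ⟩ := Hardy.nonempty_equiv_wandering_twistedM (E := E) q
    obtain ⟨τ⟩ := h.nonempty_wandering_equiv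
    exact ⟨h.isDoublyQCommutative (Hardy.isDoublyQCommutative_twistedM q), ⟨φ.trans τ.symm⟩⟩
  · rintro ⟨h, ⟨φ⟩⟩
    exact pairUnitarilyEquivalent_of_isHilbertSum_translate (Unitary.toUnits q).ne_zero h.1
      (Hardy.isDoublyQCommutative_twistedM q).1
      (h.isHilbertSum_translate (Unitary.toUnits q).ne_zero h₁ h₂ φ)
      (Hardy.isHilbertSum_translate_twistedM q)

end Model

end QShift

theorem corollaryC {H : Type u} [NormedAddCommGroup H] [InnerProductSpace ℂ H] [CompleteSpace H]
    (q : ℂ) (hq : ‖q‖ = 1) (V₁ V₂ : H →L[ℂ] H)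
    (h₁ : QShift.IsShift V₁) (h₂ : QShift.IsShift V₂) :
    (QShift.IsDoublyQCommutative q V₁ V₂ ↔
      ∃ (E : Type u) (_ : NormedAddCommGroup E) (_ : InnerProductSpace ℂ E)
        (_ : CompleteSpace E), QShift.HasTwistedHardyModel q V₁ V₂ E) ∧
    (QShift.IsDoublyQCommutative q V₁ V₂ ∧
        Module.finrank ℂ
          ↥(LinearMap.ker (ContinuousLinearMap.adjoint V₁).toLinearMap ⊓
            LinearMap.ker (ContinuousLinearMap.adjoint V₂).toLinearMap) = 1 ↔
      QShift.HasTwistedHardyModel q V₁ V₂ ℂ) := by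
  lift q to unitary ℂ using Unitary.mem_iff_star_mul_self.2 (by simp [Complex.conj_mul', hq])
  refine ⟨⟨fun h => ?_, ?_⟩, ?_⟩
  · exact ⟨QShift.wandering V₁ V₂, inferInstance, inferInstance, inferInstance,
      (QShift.hasTwistedHardyModel_iff h₁ h₂).2 ⟨h, ⟨.refl ℂ _⟩⟩⟩
  · rintro ⟨E, _, _, _, h⟩
    exact ((QShift.hasTwistedHardyModel_iff h₁ h₂).1 h).1
  · rw [QShift.hasTwistedHardyModel_iff h₁ h₂,
      QShift.nonempty_linearIsometryEquiv_self_iff_finrank_eq_one]
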